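/- Let $\mathbb{T}=\mathbb{R}/\mathbb{Z}$ with the metric $\|x\|_{\mathbb{T}}=\inf_{p\in\mathbb{Z}}|x-p|$, let $0<t\le 1$, and let $V:\mathbb{T}\to\mathbb{C}$ be $t$-Hölder continuous with $\log|w-V(\cdot)|\in L^1(\mathbb{T})$ for every $w\in\mathbb{C}$ (in particular $V\neq w$ almost everywhere). Put $$G_1(z)=\int_{\mathbb{T}}\log|z-V(\theta)|\,d\theta .$$ Let $\alpha$ be irrational, let $q_n$ be the denominator of the $n$-th convergent of the continued fraction expansion of $\alpha$, and let $$\beta(\alpha)=\limsup_{n\to\infty}\frac{\ln q_{n+1}}{q_n}\in[0,+\infty].$$ For $\lambda>0$ and $\theta\in\mathbb{T}$ let $\widehat{H}^V_\alpha(\lambda,\theta)$ be the bounded operator on $\ell^2(\mathbb{Z})$ given by $$(\widehat{H}^V_\alpha(\lambda,\theta)u)(n)=\lambda u(n-1)+V(\theta+n\alpha)u(n),\qquad n\in\mathbb{Z}.$$ If $z$ lies in the range $R(V)=V(\mathbb{T})$ and $$t\,\beta(\alpha)>G_1(z)-\log\lambda>0,$$ then $z\in\sigma(\widehat{H}^V_\alpha(\lambda,\theta))$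 for every $\theta\in\mathbb{T}$. -/

import Mathlib

open MeasureTheory Filter
open scoped lp ENNReal NNReal

noncomputable section

namespace QuasiPeriodic

/-- The right shift `(S u)(n) = u(n - 1)` on `ℓ²(ℤ)`. -/
def shift : ℓ²(ℤ, ℂ) →L[ℂ] ℓ²(ℤ, ℂ) :=
  LinearMap.mkContinuous
    { toFun := fun u => ⟨fun n => u (n - 1), by
        have h := (memℓp_gen_iff (p := 2) (by norm_num)).1 (lp.memℓp u)
        exact (memℓp_gen_iff (by norm_num)).2 ((Equiv.subRight (1 : ℤ)).summable_iff.2 h)⟩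
      map_add' := fun _ _ => rfl
      map_smul' := fun _ _ => rfl }
    1
    (fun u => by
      rw [one_mul, lp.norm_eq_tsum_rpow (by norm_num), lp.norm_eq_tsum_rpow (by norm_num)]
      exact le_of_eq (congrArg (· ^ (1 / (2 : ℝ≥0∞).toReal))
        ((Equiv.subRight (1 : ℤ)).tsum_eq (fun n => ‖u n‖ ^ (2 : ℝ≥0∞).toReal))))

/-- Multiplication by the quasi-periodic potential `n ↦ V(θ + nα)` on `ℓ²(ℤ)`. -/
def potential (V : C(UnitAddCircle, ℂ)) (α θ : UnitAddCircle) : ℓ²(ℤ, ℂ) →L[ℂ] ℓ²(ℤ, ℂ) :=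
  lp.mapCLM 2 (fun n : ℤ => V (θ + n • α) • ContinuousLinearMap.id ℂ ℂ) (norm_nonneg V)
    (fun n => by
      rw [norm_smul, ContinuousLinearMap.norm_id, mul_one]
      exact V.norm_coe_le_norm _)

/-- The operator `(Ĥ u)(n) = lam * u(n - 1) + V(θ + nα) * u(n)` on `ℓ²(ℤ)`. -/
def dualOp (V : C(UnitAddCircle, ℂ)) (α : UnitAddCircle) (lam : ℂ) (θ : UnitAddCircle) :
    ℓ²(ℤ, ℂ) →L[ℂ] ℓ²(ℤ, ℂ) :=
  lam • shift + potential V α θ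

theorem dualOp_apply (V : C(UnitAddCircle, ℂ)) (α : UnitAddCircle) (lam : ℂ)
    (θ : UnitAddCircle) (u : ℓ²(ℤ, ℂ)) (n : ℤ) :
    dualOp V α lam θ u n = lam * u (n - 1) + V (θ + n • α) * u n :=
  rfl

/-- `log |z - V|` is in `L¹(𝕋)`. As `Real.log 0 = 0`, the requirement that `log |z - V|` be
finite almost everywhere is written out separately. -/
def LogIntegrable (V : C(UnitAddCircle, ℂ)) (z : ℂ) : Prop :=
  (∀ᵐ θ : UnitAddCircle, V θ ≠ z) ∧
    Integrable (fun θ : UnitAddCircle => Real.log ‖z - V θ‖)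

/-- `G₁(z) = ∫_𝕋 log |z - V(θ)| dθ`. -/
def G (V : C(UnitAddCircle, ℂ)) (z : ℂ) : ℝ :=
  ∫ θ : UnitAddCircle, Real.log ‖z - V θ‖

/-- The denominator `qₙ` of the `n`-th continued fraction convergent of `α`
(`q₀ = 1`, `q₁ = a₁`, `qₙ = aₙ qₙ₋₁ + qₙ₋₂`). -/
def q (α : ℝ) (n : ℕ) : ℝ :=
  (GenContFract.of α).dens n

/-- `β(α) = limsup (ln qₙ₊₁) / qₙ`, an extended real number (it may be `+∞`). -/
def beta (α : ℝ) : EReal :=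
  limsup (fun n : ℕ => ((Real.log (q α (n + 1)) / q α n : ℝ) : EReal)) atTop

end QuasiPeriodic

end

open MeasureTheory Filter
open scoped lp ENNReal NNReal

namespace QuasiPeriodic

/-! Argue by contradiction. If `z - Ĥ` is invertible, test its inverse on vectors supported on a
block of the orbit whose first site nearly annihilates `z - V`: the product of `z - V` over the rest
of the block is then `O(lam ^ m)` (`norm_prod_le_of_notMem_spectrum`). Density of the orbit and
continuity carry this to every base point near a zero of `z - V`, and bounded entry times to every
point of the circle. Integrating logarithms gives `m * G ≤ log K + m * log lam` for all `m`, hence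
`G ≤ log lam`. -/

theorem sub_dualOp_single (V : C(UnitAddCircle, ℂ)) (α : UnitAddCircle) (lam : ℂ)
    (θ : UnitAddCircle) (z : ℂ) (n : ℤ) (a : ℂ) :
    (algebraMap ℂ (ℓ²(ℤ, ℂ) →L[ℂ] ℓ²(ℤ, ℂ)) z - dualOp V α lam θ) (lp.single 2 n a) =
      lp.single 2 n ((z - V (θ + n • α)) * a) - lp.single 2 (n + 1) (lam * a) := by
  refine lp.ext (funext fun k => ?_)
  have h1 : ∀ u : ℓ²(ℤ, ℂ),
      (algebraMap ℂ (ℓ²(ℤ, ℂ) →L[ℂ] ℓ²(ℤ, ℂ)) z - dualOp V α lam θ) u k =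
        z * u k - (lam * u (k - 1) + V (θ + k • α) * u k) := fun _ => rfl
  rw [h1, lp.coeFn_sub, Pi.sub_apply]
  simp only [lp.single_apply, Pi.single_apply]
  by_cases h : k = n
  · subst h
    simp
    ring
  · by_cases h' : k = n + 1
    · subst h'
      simp
    · have h'' : k - 1 ≠ n := fun e => h' (by omega)
      simp [h, h', h'']

/-- Finitely supported vectors that solve `(z - Ĥ) u = 0` away from the two ends of the block
`j, …, j + m`. -/
theorem exists_sub_dualOp_eq_single_sub_single (V : C(UnitAddCircle, ℂ)) (α : UnitAddCircle)
    (lam : ℂ) (θ : UnitAddCircle) (z : ℂ) (j : ℤ) (m : ℕ) :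
    ∃ u : ℓ²(ℤ, ℂ),
      u j = ∏ i ∈ Finset.range m, (z - V (θ + (j + 1 + i) • α)) ∧
      (algebraMap ℂ (ℓ²(ℤ, ℂ) →L[ℂ] ℓ²(ℤ, ℂ)) z - dualOp V α lam θ) u =
        lp.single 2 j ((z - V (θ + j • α)) *
            ∏ i ∈ Finset.range m, (z - V (θ + (j + 1 + i) • α))) -
          lp.single 2 (j + 1 + m) (lam ^ (m + 1)) := by
  induction m with
  | zero => exact ⟨lp.single 2 j 1, by simp, by rw [sub_dualOp_single]; simp⟩
  | succ m ih =>
    obtain ⟨u, hu, hTu⟩ := ih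
    -- The added vector cancels the old right-end residue and moves it one site further.
    refine ⟨(z - V (θ + (j + 1 + m) • α)) • u + lp.single 2 (j + 1 + m) (lam ^ (m + 1)), ?_, ?_⟩
    · rw [lp.coeFn_add, Pi.add_apply, lp.coeFn_smul, Pi.smul_apply, hu,
        lp.single_apply_ne 2 _ _ (by omega), Finset.prod_range_succ, smul_eq_mul, add_zero,
        mul_comm]
    · rw [map_add, map_smul, hTu, sub_dualOp_single, smul_sub, ← lp.single_smul,
        ← lp.single_smul, Finset.prod_range_succ, smul_eq_mul, smul_eq_mul]
      have e : j + 1 + (m : ℤ) + 1 = j + 1 + ((m + 1 : ℕ) : ℤ) := by push_cast; ring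
      rw [e, sub_add_sub_cancel, ← pow_succ', mul_left_comm]
      congr 3
      ring

/-- Off the spectrum, products of `z - V` along blocks of the orbit of `θ` that start near a zero
of `z - V` are at most a constant times a power of the coupling. -/
theorem norm_prod_le_of_notMem_spectrum {V : C(UnitAddCircle, ℂ)} {α : UnitAddCircle}
    {lam : ℂ} {θ : UnitAddCircle} {z : ℂ} (h : z ∉ spectrum ℂ (dualOp V α lam θ)) :
    ∃ K : ℝ, 0 < K ∧ ∀ (j : ℤ) (m : ℕ), K * ‖z - V (θ + j • α)‖ ≤ 1 / 2 →
      ∏ i ∈ Finset.range m, ‖z - V (θ + (j + 1 + i) • α)‖ ≤ 2 * K * ‖lam‖ ^ (m + 1) := by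
  obtain ⟨T, hT⟩ := spectrum.notMem_iff.1 h
  refine ⟨‖(↑T⁻¹ : ℓ²(ℤ, ℂ) →L[ℂ] ℓ²(ℤ, ℂ))‖ + 1, by positivity, fun j m hj => ?_⟩
  set K := ‖(↑T⁻¹ : ℓ²(ℤ, ℂ) →L[ℂ] ℓ²(ℤ, ℂ))‖ + 1 with hK
  obtain ⟨u, hu, hTu⟩ := exists_sub_dualOp_eq_single_sub_single V α lam θ z j m
  rw [← hT] at hTu
  have hinv : (↑T⁻¹ : ℓ²(ℤ, ℂ) →L[ℂ] ℓ²(ℤ, ℂ)) ((T : ℓ²(ℤ, ℂ) →L[ℂ] ℓ²(ℤ, ℂ)) u) = u := by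
    have := congrArg (fun S : ℓ²(ℤ, ℂ) →L[ℂ] ℓ²(ℤ, ℂ) => S u) T.inv_mul
    exact this
  rw [← norm_prod]
  set P := ∏ i ∈ Finset.range m, (z - V (θ + (j + 1 + i) • α))
  have h1 : ‖P‖ ≤ ‖u‖ := hu ▸ lp.norm_apply_le_norm two_ne_zero u j
  have h2 : ‖u‖ ≤ K * ‖(T : ℓ²(ℤ, ℂ) →L[ℂ] ℓ²(ℤ, ℂ)) u‖ := by
    conv_lhs => rw [← hinv]
    refine (ContinuousLinearMap.le_opNorm _ _).trans ?_
    gcongr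
    simp [hK]
  have h3 : ‖(T : ℓ²(ℤ, ℂ) →L[ℂ] ℓ²(ℤ, ℂ)) u‖ ≤
      ‖z - V (θ + j • α)‖ * ‖P‖ + ‖lam‖ ^ (m + 1) := by
    rw [hTu]
    refine (norm_sub_le _ _).trans_eq ?_
    rw [lp.norm_single (by norm_num), lp.norm_single (by norm_num), norm_mul, norm_pow]
  have h4 : ‖P‖ ≤ K * (‖z - V (θ + j • α)‖ * ‖P‖ + ‖lam‖ ^ (m + 1)) :=
    h1.trans (h2.trans (by gcongr))
  -- The left-end residue costs at most half of `‖P‖`, so it is absorbed on the left.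
  have h5 : K * ‖z - V (θ + j • α)‖ * ‖P‖ ≤ 1 / 2 * ‖P‖ := by gcongr
  linarith

/-- A dense orbit of a rotation of the circle enters a nonempty open set within a bounded number
of forward steps, uniformly in the starting point. -/
theorem exists_bound_forall_exists_add_nsmul_mem {α : UnitAddCircle}
    (hd : DenseRange fun n : ℤ => n • α) {U : Set UnitAddCircle} (hU : IsOpen U)
    (hne : U.Nonempty) : ∃ L : ℕ, ∀ x : UnitAddCircle, ∃ j ≤ L, x + j • α ∈ U := by
  have hcover : ∀ x : UnitAddCircle, ∃ k : ℤ, x + k • α ∈ U := fun x => by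
    obtain ⟨y, hy⟩ := hne
    obtain ⟨k, hk⟩ := hd.exists_mem_open (hU.preimage (continuous_const_add x))
      ⟨y - x, by simpa using hy⟩
    exact ⟨k, hk⟩
  obtain ⟨s, hs⟩ := (isCompact_univ (X := UnitAddCircle)).elim_finite_subcover
    (fun k : ℤ => {x | x + k • α ∈ U}) (fun k => hU.preimage (continuous_add_const _))
    (fun x _ => Set.mem_iUnion.2 (hcover x))
  set N := s.sup Int.natAbs
  refine ⟨2 * N, fun x => ?_⟩
  -- Starting from `x + N • α` makes the total step `N + k` nonnegative.
  obtain ⟨k, hk, hx⟩ := Set.mem_iUnion₂.1 (hs (Set.mem_univ (x + (N : ℤ) • α)))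
  have hkN : k.natAbs ≤ N := Finset.le_sup hk
  refine ⟨(N + k).toNat, by omega, ?_⟩
  have : (((N + k).toNat : ℕ) : ℤ) = N + k := by omega
  rw [← natCast_zsmul, this, add_smul, ← add_assoc]
  exact hx

/-- Cut the product after index `j`: the head has at most `L + 1` factors, each at most `A`, and `D`
bounds the tail. -/
theorem prod_range_le_of_forall_prod_shift_le {a : ℕ → ℝ} {A D : ℝ} {L j : ℕ}
    (ha : ∀ i, 0 ≤ a i) (haA : ∀ i, a i ≤ A) (hA : 1 ≤ A) (hj : j ≤ L)
    (hD : ∀ r, ∏ i ∈ Finset.range r, a (j + 1 + i) ≤ D) (m : ℕ) :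
    ∏ i ∈ Finset.range m, a i ≤ A ^ (L + 1) * max 1 D := by
  have hpow : ∀ k, ∏ i ∈ Finset.range k, a i ≤ A ^ k := fun k => by
    simpa using Finset.prod_le_prod (s := Finset.range k) (fun i _ => ha i) (fun i _ => haA i)
  rcases le_total m (j + 1) with hm | hm
  · calc ∏ i ∈ Finset.range m, a i ≤ A ^ m := hpow m
      _ ≤ A ^ (L + 1) * 1 := by rw [mul_one]; exact pow_le_pow_right₀ hA (by omega)
      _ ≤ _ := by gcongr; exact le_max_left _ _
  · obtain ⟨r, rfl⟩ := Nat.exists_eq_add_of_le hm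
    rw [Finset.prod_range_add]
    refine mul_le_mul ((hpow _).trans (pow_le_pow_right₀ hA (by omega)))
      ((hD r).trans (le_max_right _ _)) (Finset.prod_nonneg fun i _ => ha _) (by positivity)

/-- If `z` is in the range of `V` but not in the spectrum, then the products of `|z - V|` over all
orbit segments of length `m` are bounded by a constant times `lam ^ m`. -/
theorem exists_forall_prod_le_of_notMem_spectrum {V : C(UnitAddCircle, ℂ)} {α : UnitAddCircle}
    (hd : DenseRange fun n : ℤ => n • α) {lam : ℝ} (hlam : 0 < lam) {z : ℂ}
    (hz : z ∈ Set.range V) {θ : UnitAddCircle}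
    (h : z ∉ spectrum ℂ (dualOp V α (lam : ℂ) θ)) :
    ∃ K : ℝ, 0 < K ∧ ∀ (x : UnitAddCircle) (m : ℕ),
      ∏ i ∈ Finset.range m, ‖z - V (x + i • α)‖ ≤ K * lam ^ m := by
  obtain ⟨K, hK0, hK⟩ := norm_prod_le_of_notMem_spectrum h
  set U : Set UnitAddCircle := {x | K * ‖z - V x‖ < 1 / 2}
  have hUo : IsOpen U := isOpen_lt (by fun_prop) continuous_const
  obtain ⟨y, rfl⟩ := hz
  have hUy : y ∈ U := by simp [U]
  have hU : ∀ x ∈ U, ∀ m : ℕ,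
      ∏ i ∈ Finset.range m, ‖V y - V (x + (1 + i) • α)‖ ≤ 2 * K * lam ^ (m + 1) := by
    intro x hx m
    -- Violating the bound is an open condition, so a violation at `x` would also occur at a point
    -- of the orbit of `θ` in `U`, where `hK` forbids it.
    by_contra! hcon
    obtain ⟨j, hj1, hj2⟩ := hd.exists_mem_open
      ((hUo.inter (isOpen_lt (f := fun _ => 2 * K * lam ^ (m + 1))
        (g := fun x => ∏ i ∈ Finset.range m, ‖V y - V (x + (1 + i) • α)‖)
        continuous_const (by fun_prop))).preimage (continuous_const_add θ))
      ⟨x - θ, by simpa using ⟨hx, hcon⟩⟩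
    have hle := hK j m (le_of_lt hj1)
    rw [Complex.norm_real, Real.norm_of_nonneg hlam.le] at hle
    refine absurd hle (not_le.2 (lt_of_lt_of_eq hj2 (Finset.prod_congr rfl fun i _ => ?_)))
    rw [add_assoc, ← natCast_zsmul, ← add_smul, add_assoc]
    push_cast
    rfl
  obtain ⟨L, hL⟩ := exists_bound_forall_exists_add_nsmul_mem hd hUo ⟨y, hUy⟩
  set A := max 1 (2 * ‖V‖ / lam)
  refine ⟨A ^ (L + 1) * max 1 (2 * K * lam), by positivity, fun x m => ?_⟩
  obtain ⟨j, hj, hjU⟩ := hL x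
  -- Dividing each factor by `lam` makes the tail bound independent of its length.
  have hprod := prod_range_le_of_forall_prod_shift_le
    (a := fun i => ‖V y - V (x + i • α)‖ / lam) (A := A) (D := 2 * K * lam) (L := L) (j := j)
    (fun i => by positivity) (fun i => ?_) (le_max_left _ _) hj (fun r => ?_) m
  · rwa [Finset.prod_div_distrib, Finset.prod_const, Finset.card_range,
      div_le_iff₀ (by positivity)] at hprod
  · refine le_trans ?_ (le_max_right _ _)
    gcongr
    refine (norm_sub_le _ _).trans ?_
    linarith [V.norm_coe_le_norm y, V.norm_coe_le_norm (x + i • α)]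
  · rw [Finset.prod_div_distrib, Finset.prod_const, Finset.card_range,
      div_le_iff₀ (by positivity), mul_assoc, ← pow_succ']
    refine le_of_eq_of_le (Finset.prod_congr rfl fun i _ => ?_) (hU _ hjU r)
    rw [add_assoc x, ← add_smul, add_assoc j]

theorem nat_mul_G_eq_integral {V : C(UnitAddCircle, ℂ)} {z : ℂ} (hlog : LogIntegrable V z)
    (α : UnitAddCircle) (m : ℕ) :
    Integrable (fun x : UnitAddCircle =>
        ∑ i ∈ Finset.range m, Real.log ‖z - V (x + i • α)‖) ∧
      ∫ x : UnitAddCircle, ∑ i ∈ Finset.range m, Real.log ‖z - V (x + i • α)‖ = m * G V z := by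
  have hint : ∀ i ∈ Finset.range m,
      Integrable fun x : UnitAddCircle => Real.log ‖z - V (x + i • α)‖ :=
    fun i _ => hlog.2.comp_add_right (i • α)
  refine ⟨integrable_finsetSum _ hint, ?_⟩
  rw [integral_finsetSum _ hint]
  simp only [integral_add_right_eq_self (fun x : UnitAddCircle => Real.log ‖z - V x‖)]
  rw [Finset.sum_const, Finset.card_range, nsmul_eq_mul, G]

theorem ae_comp_add_right {X : Type*} [AddGroup X] [MeasurableSpace X] [MeasurableAdd X]
    {μ : Measure X} [μ.IsAddRightInvariant] {p : X → Prop} (h : ∀ᵐ x ∂μ, p x) (c : X) :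
    ∀ᵐ x ∂μ, p (x + c) :=
  (measurePreserving_add_right μ c).quasiMeasurePreserving.ae h

theorem LogIntegrable.ae_forall_ne {V : C(UnitAddCircle, ℂ)} {z : ℂ} (hlog : LogIntegrable V z)
    (α : UnitAddCircle) : ∀ᵐ x : UnitAddCircle, ∀ i : ℕ, V (x + i • α) ≠ z := by
  rw [ae_all_iff]
  exact fun i => ae_comp_add_right (p := fun x => V x ≠ z) hlog.1 (i • α)

theorem G_le_log_of_forall_prod_le {V : C(UnitAddCircle, ℂ)} {α : UnitAddCircle} {z : ℂ}
    (hlog : LogIntegrable V z) {lam K : ℝ} (hlam : 0 < lam) (hK : 0 < K)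
    (h : ∀ (x : UnitAddCircle) (m : ℕ),
      ∏ i ∈ Finset.range m, ‖z - V (x + i • α)‖ ≤ K * lam ^ m) :
    G V z ≤ Real.log lam := by
  have key : ∀ m : ℕ, (m : ℝ) * (G V z - Real.log lam) ≤ Real.log K := by
    intro m
    obtain ⟨hint, hsum⟩ := nat_mul_G_eq_integral hlog α m
    have hle : ∫ x : UnitAddCircle, ∑ i ∈ Finset.range m, Real.log ‖z - V (x + i • α)‖ ≤
        ∫ _ : UnitAddCircle, (Real.log K + m * Real.log lam) := by
      refine integral_mono_ae hint (integrable_const _) ?_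
      -- Zeros must be excluded: with `Real.log 0 = 0` the sum of logarithms would not be the
      -- logarithm of the product.
      filter_upwards [hlog.ae_forall_ne α] with x hx
      have hpos : ∀ i ∈ Finset.range m, 0 < ‖z - V (x + i • α)‖ := fun i _ =>
        norm_pos_iff.2 (sub_ne_zero.2 (hx i).symm)
      rw [← Real.log_prod fun i hi => (hpos i hi).ne', ← Real.log_pow,
        ← Real.log_mul hK.ne' (by positivity)]
      exact Real.log_le_log (Finset.prod_pos hpos) (h x m)
    rw [hsum, integral_const, measureReal_def, UnitAddCircle.measure_univ, ENNReal.toReal_one,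
      one_smul] at hle
    linarith
  by_contra! hlt
  obtain ⟨m, hm⟩ := exists_nat_gt (Real.log K / (G V z - Real.log lam))
  rw [div_lt_iff₀ (sub_pos.2 hlt)] at hm
  exact absurd (key m) (not_le.2 hm)

end QuasiPeriodic

theorem proposition3p6
    (V : C(UnitAddCircle, ℂ)) (hlog : ∀ w : ℂ, QuasiPeriodic.LogIntegrable V w)
    (C t : ℝ≥0) (ht0 : 0 < t) (ht1 : t ≤ 1) (hV : HolderWith C t V)
    (α : ℝ) (hα : Irrational α) (lam : ℝ) (hlam : 0 < lam)
    (z : ℂ) (hz : z ∈ Set.range V)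
    (hpos : 0 < QuasiPeriodic.G V z - Real.log lam)
    (hβ : ((QuasiPeriodic.G V z - Real.log lam : ℝ) : EReal) <
      ((t : ℝ) : EReal) * QuasiPeriodic.beta α)
    (θ : UnitAddCircle) :
    z ∈ spectrum ℂ (QuasiPeriodic.dualOp V (α : UnitAddCircle) (lam : ℂ) θ) := by
  by_contra h
  have hd : DenseRange fun n : ℤ => n • (α : UnitAddCircle) :=
    AddCircle.denseRange_zsmul_coe_iff.2 (by simpa using hα)
  obtain ⟨K, hK, hle⟩ :=
    QuasiPeriodic.exists_forall_prod_le_of_notMem_spectrum hd hlam hz h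
  exact absurd (QuasiPeriodic.G_le_log_of_forall_prod_le (hlog z) hlam hK hle)
    (not_le.2 (sub_pos.1 hpos))
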